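/- Let $p$ be a prime and let $(R,\mathfrak m)$ be a Noetherian local domain of characteristic $p$ and Krull dimension $d$ which is $F$-finite, i.e. $R$ is module-finite over itself via the Frobenius endomorphism $a\mapsto a^p$ (the residue field need not be perfect). For an ideal $I\subseteq R$ let $I^{[p]}$ be the ideal generated by $\{a^p : a\in I\}$, and let $\ell$ denote length of $R$-modules. Let $I_\bullet=\{I_q\}$ be a family of ideals of $R$ indexed by the powers $q=p^e$, $e\in\mathbb N=\{0,1,2,\dots\}$, such that - $I_\bullet$ is bounded below linearly (BBL): there is $c\in\mathbb N$ with $\mathfrak m^{cq}\subseteq I_q$ for all $q=p^e$; - $I_\bullet$ is a weakly inverse $p$-family: there is $c\in R$, $c\neq 0$, with $c\,I_{pq}\subseteq I_q^{[p]}$ for all $q=p^e$. Then every $\ell(R/I_q)$ is finite, and: 1. The limit $\displaystyle \eta=\lim_{e\to\infty}\frac{\ell(R/I_{p^e})}{p^{ed}}$ exists (as a real number). 2. There is a constant $C>0$ such that $\displaystyle \frac{\ell(R/I_q)}{q^d}-\eta\le \frac{C}{q}$ for all $q=p^e$, $e\in\mathbb N$. 3. If $I_\bullet$ is in addition a weakly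 $p$-family, i.e. there is $c\in R$, $c\ne 0$, with $c\,I_q^{[p]}\subseteq I_{pq}$ for all $q=p^e$, then there is a constant $C>0$ such that $\displaystyle \left|\frac{\ell(R/I_q)}{q^d}-\eta\right|\le\frac{C}{q}$ for all $q=p^e$, $e\in\mathbb N$. -/

import Mathlib

namespace AsymptoticColength

/-- The set `R°`: the elements of `R` outside every prime `P` with `dim R/P = dim R`.
(For a domain of finite dimension these are the nonzero elements.) -/
def circ (R : Type*) [CommRing R] : Set R :=
  {c | ∀ P : Ideal R, P.IsPrime → ringKrullDim (R ⧸ P) = ringKrullDim R → c ∉ P}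

/-- The Frobenius power `I^[q]`, the ideal generated by all `a ^ q` with `a ∈ I`. -/
def bracketPower {R : Type*} [CommRing R] (I : Ideal R) (q : ℕ) : Ideal R :=
  Ideal.span ((fun a : R => a ^ q) '' (I : Set R))

/-- `R` is `F`-finite: the target of the Frobenius endomorphism is a finitely generated
module over its source. -/
def IsFFinite (R : Type*) [CommRing R] (p : ℕ) [ExpChar R p] : Prop :=
  (frobenius R p).Finite

/-! A family of ideals indexed by the powers of `p` is a function `I : ℕ → Ideal R`,
with `I e` in the role of the ideal of index `q = p ^ e`. -/

/-- Weakly `p`-family: there is `c ∈ R°` with `c · I_q^[p] ⊆ I_{pq}` for all `q = p ^ e`. -/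
def IsWeaklyPFamily {R : Type*} [CommRing R] (p : ℕ) (I : ℕ → Ideal R) : Prop :=
  ∃ c ∈ circ R, ∀ e : ℕ, Ideal.span {c} * bracketPower (I e) p ≤ I (e + 1)

/-- Weakly inverse `p`-family: there is `c ∈ R°` with `c · I_{pq} ⊆ I_q^[p]` for all
`q = p ^ e`. -/
def IsWeaklyInversePFamily {R : Type*} [CommRing R] (p : ℕ) (I : ℕ → Ideal R) : Prop :=
  ∃ c ∈ circ R, ∀ e : ℕ, Ideal.span {c} * I (e + 1) ≤ bracketPower (I e) p

/-- Bounded below linearly (BBL): there is `c ∈ ℕ` with `𝔪 ^ (c q) ⊆ I_q` for all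
`q = p ^ e`. -/
def IsBBL {R : Type*} [CommRing R] [IsLocalRing R] (p : ℕ) (I : ℕ → Ideal R) : Prop :=
  ∃ c : ℕ, ∀ e : ℕ, IsLocalRing.maximalIdeal R ^ (c * p ^ e) ≤ I e

/-- The length of `R/I` as a real number (meaningful when this length is finite). -/
noncomputable def colength {R : Type*} [CommRing R] (I : Ideal R) : ℝ :=
  ((Module.length R (R ⧸ I)).toNat : ℝ)

end AsymptoticColength

/-! Write `u e = ℓ(R/I_q)/q^d` with `q = p^e`. Everything follows from `u e ≤ u (e+1) + C/q`: then
`u e - 2C/q` is nondecreasing and bounded above, so `u` converges, and the same monotonicity gives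
the one-sided rate. Under the weakly `p`-family condition the inequality also holds for `-u`.

That inequality combines two estimates with error `O(n^(d-1))`, for ideals containing `y^n` for
every `y ∈ 𝔪`. If `c ≠ 0` and `cK ⊆ I`, then `ℓ(R/I) ≤ ℓ(R/K) + ℓ(R/(I+c))`, and the last term is
small because `R/c` has smaller dimension (`exists_colength_le_add`). Also, `ℓ(R/I^[p])` is close to
`p^d ℓ(R/I)` (`exists_abs_colength_bracketPower_sub_le`): up to torsion, `R` over itself via
Frobenius is free of some rank `r`, which gives a factor `r/s` with `s` the residue degree of
Frobenius. That `r/s = p^d` is deduced by iterating on the Frobenius powers of `𝔪`, whose colengths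
grow exactly like `q^d`. -/

namespace AsymptoticColength

open Module

/-! ### Lengths of quotients and filtrations by powers of an element. -/

section Length

variable {R : Type*} [CommRing R]

lemma length_le_add_length_quotient_range {M N : Type*} [AddCommGroup M] [Module R M]
    [AddCommGroup N] [Module R N] (f : M →ₗ[R] N) :
    length R N ≤ length R M + length R (N ⧸ LinearMap.range f) := by
  rw [length_eq_add_of_exact (LinearMap.range f).subtype (LinearMap.range f).mkQ
    (Submodule.subtype_injective _) (Submodule.mkQ_surjective _)
    (LinearMap.exact_subtype_mkQ _)]
  gcongr
  exact length_le_of_surjective f.rangeRestrict f.surjective_rangeRestrict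

lemma length_quotient_anti {M : Type*} [AddCommGroup M] [Module R M] {P Q : Submodule R M}
    (h : P ≤ Q) : length R (M ⧸ Q) ≤ length R (M ⧸ P) :=
  length_le_of_surjective (Submodule.factor h) (Submodule.factor_surjective h)

/-- From the exact sequence `0 → R/(I : c) → R/I → R/(I + c) → 0`, the first map being
multiplication by `c`. -/
lemma length_quotient_eq_colon_add (I : Ideal R) (c : R) :
    length R (R ⧸ I) =
      length R (R ⧸ (Submodule.comap (LinearMap.mulLeft R c) I : Ideal R)) +
        length R (R ⧸ (I ⊔ Ideal.span {c})) := by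
  refine length_eq_add_of_exact
    (Submodule.mapQ (Submodule.comap (LinearMap.mulLeft R c) I) I (LinearMap.mulLeft R c) le_rfl)
    (Submodule.factor (le_sup_left : I ≤ I ⊔ Ideal.span {c})) ?_
    (Submodule.factor_surjective _) ?_
  · rw [← LinearMap.ker_eq_bot, Submodule.ker_mapQ, Submodule.mkQ_map_self]
  · intro y
    obtain ⟨y, rfl⟩ := Submodule.mkQ_surjective _ y
    have h1 : (Submodule.factor (le_sup_left : I ≤ I ⊔ Ideal.span {c})) (I.mkQ y) =
      (I ⊔ Ideal.span {c}).mkQ y := rfl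
    rw [h1, Submodule.mkQ_apply, Submodule.Quotient.mk_eq_zero, Set.mem_range]
    constructor
    · intro hy
      obtain ⟨a, ha, b, hb, rfl⟩ := Submodule.mem_sup.1 hy
      obtain ⟨z, rfl⟩ := Ideal.mem_span_singleton'.1 hb
      refine ⟨Submodule.mkQ _ z, ?_⟩
      change I.mkQ (c * z) = _
      rw [Submodule.mkQ_apply, Submodule.mkQ_apply, Submodule.Quotient.eq]
      convert! I.neg_mem ha using 1
      ring
    · rintro ⟨z, hz⟩
      obtain ⟨z, rfl⟩ := Submodule.mkQ_surjective _ z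
      change I.mkQ (c * z) = _ at hz
      rw [Submodule.mkQ_apply, Submodule.mkQ_apply, Submodule.Quotient.eq] at hz
      have : y = -(c * z - y) + z * c := by ring
      rw [this]
      exact Submodule.add_mem_sup (I.neg_mem hz) (Ideal.mem_span_singleton'.2 ⟨z, rfl⟩)

lemma length_quotient_le_add_of_mul_mem {I K : Ideal R} {c : R} (h : ∀ x ∈ K, c * x ∈ I) :
    length R (R ⧸ I) ≤ length R (R ⧸ K) + length R (R ⧸ (I ⊔ Ideal.span {c})) := by
  rw [length_quotient_eq_colon_add I c]
  gcongr
  exact length_quotient_anti h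

lemma add_le_length_quotient_of_mem_of_mul_mem {I K : Ideal R} {c : R}
    (h : ∀ x, c * x ∈ I → x ∈ K) :
    length R (R ⧸ K) + length R (R ⧸ (I ⊔ Ideal.span {c})) ≤ length R (R ⧸ I) := by
  rw [length_quotient_eq_colon_add I c]
  gcongr
  exact length_quotient_anti (P := (Submodule.comap (LinearMap.mulLeft R c) I : Ideal R)) h

lemma length_quotient_top : length R (R ⧸ (⊤ : Ideal R)) = 0 :=
  length_eq_zero

lemma length_quotient_sup_span_pow_le (J : Ideal R) (x : R) (n : ℕ) :
    length R (R ⧸ (J ⊔ Ideal.span {x ^ n})) ≤ n * length R (R ⧸ (J ⊔ Ideal.span {x})) := by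
  induction n with
  | zero =>
    have : J ⊔ Ideal.span {x ^ 0} = ⊤ := by simp
    rw [this, length_quotient_top]
    exact zero_le
  | succ n ih =>
    have h := length_quotient_le_add_of_mul_mem (I := J ⊔ Ideal.span {x ^ (n + 1)})
      (K := J ⊔ Ideal.span {x}) (c := x ^ n) (by
        intro y hy
        obtain ⟨a, ha, b, hb, rfl⟩ := Submodule.mem_sup.1 hy
        obtain ⟨z, rfl⟩ := Ideal.mem_span_singleton'.1 hb
        rw [mul_add]
        exact Submodule.add_mem_sup (J.mul_mem_left _ ha)
          (Ideal.mem_span_singleton'.2 ⟨z, by ring⟩))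
    refine h.trans ?_
    rw [Nat.cast_succ, add_mul, one_mul, add_comm]
    gcongr
    refine le_trans (length_quotient_anti ?_) ih
    exact sup_le_sup_right le_sup_left _

lemma length_quotient_sup_span_image_pow_le (s : Finset R) (n : ℕ) (J : Ideal R) :
    length R (R ⧸ (J ⊔ Ideal.span ((fun x => x ^ n) '' (s : Set R)))) ≤
      n ^ s.card * length R (R ⧸ (J ⊔ Ideal.span (s : Set R))) := by
  classical
  induction s using Finset.induction_on generalizing J with
  | empty =>
    rw [Finset.coe_empty, Set.image_empty]
    simp
  | insert a s ha ih =>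
    have h1 := ih (J ⊔ Ideal.span {a ^ n})
    have h2 := length_quotient_sup_span_pow_le (J ⊔ Ideal.span (s : Set R)) a n
    rw [Finset.card_insert_of_notMem ha, Finset.coe_insert, Set.image_insert_eq,
      Ideal.span_insert, Ideal.span_insert, ← sup_assoc, ← sup_assoc, pow_succ, mul_assoc]
    refine h1.trans ?_
    gcongr
    rw [sup_right_comm, sup_right_comm J (Ideal.span {a})]
    exact h2

end Length

/-! ### Upper bounds on colength through systems of parameters. -/

section UpperBound

variable {R : Type*} [CommRing R] [IsLocalRing R] [IsNoetherianRing R]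

/-- Lifts to `R` a system of parameters of `R/J`, obtained from the height of its maximal ideal. -/
lemma exists_finset_length_quotient_ne_top {J : Ideal R} (hJ : J ≠ ⊤) {n : ℕ}
    (hn : ringKrullDim (R ⧸ J) ≤ n) :
    ∃ s : Finset R, (∀ x ∈ s, x ∈ IsLocalRing.maximalIdeal R) ∧ s.card ≤ n ∧
      length R (R ⧸ (J ⊔ Ideal.span (s : Set R))) ≠ ⊤ := by
  classical
  have : Nontrivial (R ⧸ J) := Ideal.Quotient.nontrivial_iff.2 hJ
  have hsurj := Ideal.Quotient.mk_surjective (I := J)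
  have : IsLocalRing (R ⧸ J) := IsLocalRing.of_surjective' _ hsurj
  have : IsLocalHom (Ideal.Quotient.mk J) := IsLocalHom.of_surjective _ hsurj
  obtain ⟨t, ht, htc⟩ :=
    (IsLocalRing.maximalIdeal (R ⧸ J)).exists_finset_card_eq_height_of_isNoetherianRing
  have hheight := IsLocalRing.maximalIdeal_height_eq_ringKrullDim (R := R ⧸ J)
  rw [← htc] at hheight
  rw [← hheight] at hn
  have hcard : t.card ≤ n := by exact_mod_cast hn
  let g := Function.surjInv hsurj
  have hg : ∀ x, Ideal.Quotient.mk J (g x) = x := Function.surjInv_eq hsurj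
  have hmax : (IsLocalRing.maximalIdeal (R ⧸ J)).comap (Ideal.Quotient.mk J) =
      IsLocalRing.maximalIdeal R := IsLocalRing.maximalIdeal_comap _
  have hmin := Ideal.minimalPrimes_comap_of_surjective hsurj ht
  have hspan : Ideal.span (t : Set (R ⧸ J)) =
      (Ideal.span (t.image g : Set R)).map (Ideal.Quotient.mk J) := by
    rw [Ideal.map_span, Finset.coe_image, Set.image_image]
    simp [hg]
  have hker : RingHom.ker (Ideal.Quotient.mk J) = J := Ideal.mk_ker
  rw [hmax, hspan, Ideal.comap_map_of_surjective' _ hsurj, hker, sup_comm] at hmin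
  have := IsLocalRing.quotient_artinian_of_mem_minimalPrimes_of_isLocalRing _ hmin
  refine ⟨t.image g, fun x hx => ?_, Finset.card_image_le.trans hcard, ?_⟩
  · exact hmin.1.2 ((le_sup_right : _ ≤ J ⊔ _) (Ideal.subset_span hx))
  · rw [length_eq_of_surjective (R := R ⧸ (J ⊔ Ideal.span (t.image g : Set R)))
      Ideal.Quotient.mk_surjective]
    exact length_ne_top

/-- Only `n`-th powers of at most `d` parameters are needed, so the hypothesis asks for `y ^ n ∈ I`
rather than `𝔪 ^ n ≤ I`; this form passes to Frobenius powers with no loss. -/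
lemma exists_length_quotient_sup_le {J : Ideal R} (hJ : J ≠ ⊤) {d : ℕ}
    (hd : ringKrullDim (R ⧸ J) ≤ d) :
    ∃ C : ℕ, ∀ (n : ℕ) (I : Ideal R), (∀ y ∈ IsLocalRing.maximalIdeal R, y ^ n ∈ I) →
      length R (R ⧸ (I ⊔ J)) ≤ (C * n ^ d : ℕ) := by
  obtain ⟨s, hsm, hsc, hs⟩ := exists_finset_length_quotient_ne_top hJ hd
  obtain ⟨C, hC⟩ := ENat.ne_top_iff_exists.1 hs
  refine ⟨C, fun n I hI => ?_⟩
  rcases Nat.eq_zero_or_pos n with rfl | hn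
  · have htop : I ⊔ J = ⊤ := by
      rw [Ideal.eq_top_iff_one]
      exact (le_sup_left : I ≤ _) (by simpa using hI 0 (Ideal.zero_mem _))
    rw [htop, length_quotient_top]
    exact zero_le
  · have h1 : J ⊔ Ideal.span ((fun x => x ^ n) '' (s : Set R)) ≤ I ⊔ J := by
      refine sup_le le_sup_right (le_trans (Ideal.span_le.2 ?_) le_sup_left)
      rintro _ ⟨x, hx, rfl⟩
      exact hI x (hsm x hx)
    refine (length_quotient_anti h1).trans
      ((length_quotient_sup_span_image_pow_le s n J).trans ?_)
    rw [← hC, mul_comm]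
    have : C * n ^ s.card ≤ C * n ^ d := by gcongr
    exact_mod_cast this

lemma exists_length_quotient_le {d : ℕ} (hd : ringKrullDim R = d) :
    ∃ C : ℕ, ∀ (n : ℕ) (I : Ideal R), (∀ y ∈ IsLocalRing.maximalIdeal R, y ^ n ∈ I) →
      length R (R ⧸ I) ≤ (C * n ^ d : ℕ) := by
  have h : ringKrullDim (R ⧸ (⊥ : Ideal R)) ≤ d := by
    rw [ringKrullDim_eq_of_ringEquiv (RingEquiv.quotientBot R), hd]
  obtain ⟨C, hC⟩ := exists_length_quotient_sup_le bot_ne_top h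
  refine ⟨C, fun n I hI => ?_⟩
  have := hC n I hI
  rwa [sup_bot_eq] at this

lemma exists_length_quotient_sup_span_mul_le [IsDomain R] {d : ℕ} (hd : ringKrullDim R = d)
    {c : R} (hc : c ≠ 0) :
    ∃ C : ℕ, ∀ (n : ℕ) (I : Ideal R), (∀ y ∈ IsLocalRing.maximalIdeal R, y ^ n ∈ I) →
      length R (R ⧸ (I ⊔ Ideal.span {c})) * n ≤ (C * n ^ d : ℕ) := by
  by_cases htop : Ideal.span {c} = ⊤
  · refine ⟨0, fun n I _ => ?_⟩
    rw [htop, sup_top_eq, length_quotient_top]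
    simp
  have h := ringKrullDim_quotient_succ_le_of_nonZeroDivisor (mem_nonZeroDivisors_of_ne_zero hc)
  rw [hd] at h
  have : Nontrivial (R ⧸ Ideal.span {c}) := Ideal.Quotient.nontrivial_iff.2 htop
  -- A nonzero nonunit lowers the dimension, so `d = 0` cannot occur here.
  obtain ⟨d, rfl⟩ : ∃ k, d = k + 1 := by
    refine Nat.exists_eq_succ_of_ne_zero ?_
    rintro rfl
    have h0 : (0 : WithBot ℕ∞) ≤ ringKrullDim (R ⧸ Ideal.span {c}) := ringKrullDim_nonneg_of_nontrivial
    have : (0 : WithBot ℕ∞) + 1 ≤ 0 := (by gcongr : (0 : WithBot ℕ∞) + 1 ≤ _).trans h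
    exact absurd this (by decide)
  have h' : ringKrullDim (R ⧸ Ideal.span {c}) ≤ d := by
    rw [Nat.cast_succ] at h
    exact (ENat.WithBot.add_le_add_one_right_iff).1 h
  obtain ⟨C, hC⟩ := exists_length_quotient_sup_le htop h'
  refine ⟨C, fun n I hI => ?_⟩
  calc _ ≤ ((C * n ^ d : ℕ) : ℕ∞) * n := by gcongr; exact hC n I hI
    _ = _ := by push_cast; ring

end UpperBound

/-! ### Lower bound `ℓ(R/𝔪^n) ≥ n^d / D` through chains of primes. -/

section LowerBound

variable {R : Type*} [CommRing R] [IsNoetherianRing R]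

/-- Artin–Rees for the submodule generated by `x` in the domain `R/P`, where `x` can be cancelled.
-/
lemma exists_mem_sup_pow_of_mul_mem (m P : Ideal R) [P.IsPrime] {x : R} (hx : x ∉ P) :
    ∃ k : ℕ, ∀ (n : ℕ) (y : R), x * y ∈ P ⊔ m ^ n → y ∈ P ⊔ m ^ (n - k) := by
  obtain ⟨k, hk⟩ := m.exists_pow_inf_eq_pow_smul (Submodule.span R {Ideal.Quotient.mk P x})
  refine ⟨k, fun n y hy => ?_⟩
  rcases lt_or_ge n k with hn | hn
  · simp [Nat.sub_eq_zero_of_le hn.le]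
  obtain ⟨u, hu, w, hw, huw⟩ := Submodule.mem_sup.1 hy
  have h1 : Ideal.Quotient.mk P (x * y) ∈ (m ^ n • ⊤ : Submodule R (R ⧸ P)) := by
    have : Ideal.Quotient.mk P (x * y) = w • (1 : R ⧸ P) := by
      rw [← huw, map_add, Ideal.Quotient.eq_zero_iff_mem.2 hu, zero_add, Algebra.smul_def, mul_one]
      rfl
    rw [this]
    exact Submodule.smul_mem_smul hw trivial
  have h2 : Ideal.Quotient.mk P (x * y) ∈ Submodule.span R {Ideal.Quotient.mk P x} :=
    Submodule.mem_span_singleton.2 ⟨y, by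
      rw [Algebra.smul_def, mul_comm x, map_mul]
      rfl⟩
  have h3 := (hk n hn).le ⟨h1, h2⟩
  have h4 := (Submodule.smul_mono le_rfl inf_le_right) h3
  obtain ⟨z, hz, hzx⟩ := Submodule.mem_smul_span_singleton.1 h4
  have h5 : x * (y - z) ∈ P := by
    rw [← Ideal.Quotient.eq_zero_iff_mem, mul_sub, map_sub, ← hzx, Algebra.smul_def,
      mul_comm x z, map_mul (Ideal.Quotient.mk P) z x]
    exact sub_self _
  have h6 := (Ideal.IsPrime.mem_or_mem ‹_› h5).resolve_left hx
  have : y = (y - z) + z := by ring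
  rw [this]
  exact Submodule.add_mem_sup h6 hz

/-- Pick `x ∈ Q \ P` and filter by powers of `x`. By Artin–Rees the `j`-th layer surjects onto `R/(Q
+ m^(n - jk))`, so `J` layers contribute `J` times a common lower bound. The factor `D` avoids
division in `ℕ∞`. -/
lemma exists_mul_le_length_quotient_sup_pow (m P Q : Ideal R) [P.IsPrime] (hPQ : P < Q) :
    ∃ k : ℕ, 0 < k ∧ ∀ (n J : ℕ) (T D : ℕ∞),
      (∀ j < J, T ≤ D * length R (R ⧸ (Q ⊔ m ^ (n - j * k)))) →
      J * T ≤ D * length R (R ⧸ (P ⊔ m ^ n)) := by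
  obtain ⟨x, hxQ, hxP⟩ := SetLike.exists_of_lt hPQ
  obtain ⟨k, hk⟩ := exists_mem_sup_pow_of_mul_mem m P hxP
  have hk' (j : ℕ) : ∀ (n : ℕ) (y : R), x ^ j * y ∈ P ⊔ m ^ n →
      y ∈ P ⊔ m ^ (n - j * (k + 1)) := by
    induction j with
    | zero => simp
    | succ j ih =>
      intro n y hy
      have h1 := ih _ _ (hk n (x ^ j * y) (by convert! hy using 1; ring))
      refine (sup_le_sup_left (α := Ideal R) (Ideal.pow_le_pow_right ?_) P) h1
      rw [Nat.sub_sub, add_mul]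
      omega
  refine ⟨k + 1, Nat.succ_pos k, fun n J T D hT => ?_⟩
  suffices h : J * T ≤ D * length R (R ⧸ (P ⊔ m ^ n ⊔ Ideal.span {x ^ J})) from
    h.trans (by gcongr; exact length_quotient_anti le_sup_left)
  induction J with
  | zero => simp
  | succ j ih =>
    have h1 := ih fun i hi => hT i (hi.trans (Nat.lt_succ_self j))
    have h2 := add_le_length_quotient_of_mem_of_mul_mem (I := P ⊔ m ^ n ⊔ Ideal.span {x ^ (j + 1)})
      (K := Q ⊔ m ^ (n - j * (k + 1))) (c := x ^ j) (by
        intro z hz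
        obtain ⟨u, hu, v, hv, huv⟩ := Submodule.mem_sup.1 hz
        obtain ⟨w, rfl⟩ := Ideal.mem_span_singleton'.1 hv
        have h3 : x ^ j * (z - w * x) ∈ P ⊔ m ^ n := by
          convert! hu using 1
          linear_combination -huv
        have h4 := sup_le_sup_right hPQ.le _ (hk' _ _ _ h3)
        have : z = (z - w * x) + w * x := by ring
        rw [this]
        exact add_mem h4 ((le_sup_left : Q ≤ _) (Q.mul_mem_left _ hxQ)))
    refine le_trans ?_ (mul_le_mul_right h2 D)
    rw [Nat.cast_succ, add_mul, one_mul, add_comm, mul_add]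
    refine add_le_add (hT j (Nat.lt_succ_self j)) ?_
    have h5 : Ideal.span {x ^ (j + 1)} ≤ Ideal.span {x ^ j} :=
      Ideal.span_singleton_le_span_singleton.2 (pow_dvd_pow x j.le_succ)
    have h6 : P ⊔ m ^ n ⊔ Ideal.span {x ^ (j + 1)} ⊔ Ideal.span {x ^ j} ≤
        P ⊔ m ^ n ⊔ Ideal.span {x ^ j} :=
      sup_le (sup_le le_sup_left (h5.trans le_sup_right)) le_sup_right
    exact h1.trans (mul_le_mul_right (length_quotient_anti h6) D)

lemma exists_pow_le_length_quotient_sup_pow [IsLocalRing R] (d : ℕ) :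
    ∀ l : LTSeries (PrimeSpectrum R), l.length = d → ∃ D : ℕ, ∀ n : ℕ, 0 < n →
      ((n ^ d : ℕ) : ℕ∞) ≤
        D * length R (R ⧸ (l.head.asIdeal ⊔ IsLocalRing.maximalIdeal R ^ n)) := by
  induction d with
  | zero =>
    intro l _
    refine ⟨1, fun n hn => ?_⟩
    have : Nontrivial (R ⧸ (l.head.asIdeal ⊔ IsLocalRing.maximalIdeal R ^ n)) := by
      rw [Ideal.Quotient.nontrivial_iff]
      refine ne_top_of_le_ne_top (IsLocalRing.maximalIdeal.isMaximal R).ne_top (sup_le ?_ ?_)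
      · exact IsLocalRing.le_maximalIdeal l.head.isPrime.ne_top
      · exact Ideal.pow_le_self hn.ne'
    have h := length_pos (R := R)
      (M := R ⧸ (l.head.asIdeal ⊔ IsLocalRing.maximalIdeal R ^ n))
    simpa using Order.one_le_iff_pos.2 h
  | succ d ih =>
    intro l hl
    have hl0 : l.length ≠ 0 := by omega
    obtain ⟨D, hD⟩ := ih (l.tail hl0) (by simp [hl])
    have hlt : l.head < (l.tail hl0).head := by
      have : NeZero l.length := ⟨hl0⟩
      rw [RelSeries.head_tail]
      exact LTSeries.strictMono l (Fin.pos_iff_ne_zero.2 (by simp))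
    obtain ⟨k, hk0, hk⟩ := exists_mul_le_length_quotient_sup_pow (IsLocalRing.maximalIdeal R)
      l.head.asIdeal (l.tail hl0).head.asIdeal hlt
    refine ⟨2 * k * (2 ^ d * D), fun n hn => ?_⟩
    have h2k : 0 < 2 * k := by omega
    -- About `n/(2k)` layers keep the exponent `n - jk` at least `n/2`; this halving costs the
    -- factor `2^d`.
    have h := hk n (n / (2 * k) + 1) ((n ^ d : ℕ) : ℕ∞) ((2 ^ d * D : ℕ) : ℕ∞) (by
      intro j hj
      have hj' : j * (2 * k) ≤ n := (Nat.le_div_iff_mul_le h2k).1 (Nat.lt_succ_iff.1 hj)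
      have hjk : j * (2 * k) = 2 * (j * k) := by ring
      have ht : n ≤ 2 * (n - j * k) := by omega
      have h1 : ((n ^ d : ℕ) : ℕ∞) ≤ (2 ^ d * (n - j * k) ^ d : ℕ) := by
        rw [← mul_pow]
        exact_mod_cast Nat.pow_le_pow_left ht d
      refine h1.trans ?_
      rw [Nat.cast_mul, Nat.cast_mul, mul_assoc]
      gcongr
      exact hD _ (by omega))
    have hn' : n ≤ 2 * k * (n / (2 * k) + 1) := (Nat.lt_mul_div_succ n h2k).le
    calc ((n ^ (d + 1) : ℕ) : ℕ∞) ≤ (2 * k * ((n / (2 * k) + 1) * n ^ d) : ℕ) := by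
          rw [pow_succ', ← mul_assoc]
          exact_mod_cast Nat.mul_le_mul_right _ hn'
      _ = (2 * k : ℕ) * (((n / (2 * k) + 1 : ℕ) : ℕ∞) * (n ^ d : ℕ)) := by
          rw [← Nat.cast_mul, ← Nat.cast_mul]
      _ ≤ _ := mul_le_mul_right h _
      _ = _ := by rw [← mul_assoc, ← Nat.cast_mul]

lemma exists_pow_le_length_quotient_pow [IsLocalRing R] {d : ℕ} (hd : ringKrullDim R = d) :
    ∃ D : ℕ, ∀ n : ℕ, 0 < n →
      ((n ^ d : ℕ) : ℕ∞) ≤ D * length R (R ⧸ IsLocalRing.maximalIdeal R ^ n) := by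
  obtain ⟨l, hl⟩ := (Order.le_krullDim_iff (α := PrimeSpectrum R)).1 hd.ge
  obtain ⟨D, hD⟩ := exists_pow_le_length_quotient_sup_pow d l hl
  refine ⟨D, fun n hn => (hD n hn).trans ?_⟩
  gcongr
  exact length_quotient_anti le_sup_right

end LowerBound

/-! ### Comparing a finite module over a domain with a free module. -/

section Comparison

variable {R : Type*} [CommRing R]

lemma length_le_mul_length_quotient {Q : Type*} [AddCommGroup Q] [Module R Q] {b : ℕ}
    (G : (Fin b → R) →ₗ[R] Q) (hG : Function.Surjective G) {K : Ideal R}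
    (hK : K ≤ Module.annihilator R Q) : length R Q ≤ b * length R (R ⧸ K) := by
  have h : Submodule.pi Set.univ (fun _ : Fin b => K) ≤ LinearMap.ker G := by
    intro x hx
    rw [LinearMap.mem_ker, LinearMap.pi_apply_eq_sum_univ G x]
    exact Finset.sum_eq_zero fun i _ =>
      Module.mem_annihilator.1 (hK (hx i (Set.mem_univ i))) _
  have h1 : length R Q ≤ length R ((Fin b → R) ⧸ Submodule.pi Set.univ (fun _ : Fin b => K)) :=
    length_le_of_surjective (Submodule.liftQ _ G h) (by
      rw [← LinearMap.range_eq_top, Submodule.range_liftQ, LinearMap.range_eq_top]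
      exact hG)
  rw [(Submodule.quotientPi (fun _ : Fin b => K)).length_eq] at h1
  simpa using h1

lemma length_pi_quotient_smul_top (I : Ideal R) (r : ℕ) :
    length R ((Fin r → R) ⧸ (I • ⊤ : Submodule R (Fin r → R))) = r * length R (R ⧸ I) := by
  have h : (I • ⊤ : Submodule R (Fin r → R)) = Submodule.pi Set.univ (fun _ : Fin r => I) := by
    refine le_antisymm (Submodule.smul_le.2 fun a ha v _ i _ => I.mul_mem_right _ ha) ?_
    intro x hx
    rw [pi_eq_sum_univ' x]
    exact Submodule.sum_mem _ fun i _ => Submodule.smul_mem_smul (hx i (Set.mem_univ i)) trivial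
  rw [h, (Submodule.quotientPi (fun _ : Fin r => I)).length_eq]
  simp

/-- The cokernel of `M/IM → N/IN` is killed by `I` and `c` and needs at most `b` generators, where
`b` depends on `N` alone. -/
lemma exists_length_quotient_smul_top_le {M N : Type*} [AddCommGroup M] [Module R M]
    [AddCommGroup N] [Module R N] [Module.Finite R N] (f : M →ₗ[R] N) {c : R}
    (hc : ∀ x, c • x ∈ LinearMap.range f) :
    ∃ b : ℕ, ∀ I : Ideal R, length R (N ⧸ (I • ⊤ : Submodule R N)) ≤
      length R (M ⧸ (I • ⊤ : Submodule R M)) + b * length R (R ⧸ (I ⊔ Ideal.span {c})) := by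
  obtain ⟨b, g, hg⟩ := Module.Finite.exists_fin' R N
  refine ⟨b, fun I => ?_⟩
  have hle : (I • ⊤ : Submodule R M) ≤ Submodule.comap f (I • ⊤ : Submodule R N) := by
    rw [← Submodule.map_le_iff_le_comap, Submodule.map_smul'']
    exact Submodule.smul_mono le_rfl le_top
  let f' := Submodule.mapQ _ _ f hle
  refine (length_le_add_length_quotient_range f').trans (add_le_add le_rfl ?_)
  refine length_le_mul_length_quotient
    ((LinearMap.range f').mkQ ∘ₗ (I • ⊤ : Submodule R N).mkQ ∘ₗ g) ?_ ?_
  · exact (Submodule.mkQ_surjective _).comp ((Submodule.mkQ_surjective _).comp hg)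
  · refine sup_le (fun a ha => ?_) ((Ideal.span_singleton_le_iff_mem _).2 ?_)
    all_goals
      rw [Module.mem_annihilator]
      intro q
      obtain ⟨q, rfl⟩ := Submodule.mkQ_surjective _ q
      obtain ⟨q, rfl⟩ := Submodule.mkQ_surjective _ q
      rw [← map_smul, ← map_smul]
    · rw [Submodule.mkQ_apply (I • ⊤ : Submodule R N),
        (Submodule.Quotient.mk_eq_zero (I • ⊤ : Submodule R N)).2
        (Submodule.smul_mem_smul ha trivial), map_zero]
    · obtain ⟨y, hy⟩ := hc q
      rw [Submodule.mkQ_apply, Submodule.Quotient.mk_eq_zero, ← hy]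
      exact ⟨Submodule.mkQ _ y, rfl⟩

lemma exists_maps_to_from_free [IsDomain R] (M : Type*) [AddCommGroup M] [Module R M]
    [Module.Finite R M] :
    ∃ (r : ℕ) (f : (Fin r → R) →ₗ[R] M) (g : M →ₗ[R] (Fin r → R)) (c : R), c ≠ 0 ∧
      (∀ x, c • x ∈ LinearMap.range f) ∧ ∀ v : Fin r → R, c • v ∈ LinearMap.range g := by
  obtain ⟨v, hv⟩ := exists_linearIndependent_of_le_finrank (R := R) (M := M) le_rfl
  let f := Fintype.linearCombination R v
  have hf : Function.Injective f := hv.fintypeLinearCombination_injective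
  have hr : finrank R (LinearMap.range f) = finrank R M := by
    rw [LinearMap.finrank_range_of_inj hf]
    simp
  have h0 : finrank R (M ⧸ LinearMap.range f) = 0 := by
    have := Submodule.finrank_quotient_add_finrank (LinearMap.range f)
    omega
  have ht := Module.finrank_eq_zero_iff_isTorsion.1 h0
  obtain ⟨c, hc, hc0⟩ := Submodule.annihilator_top_inter_nonZeroDivisors ht
  have hcf : ∀ x, c • x ∈ LinearMap.range f := by
    intro x
    have := Submodule.mem_annihilator.1 hc ((LinearMap.range f).mkQ x) trivial
    rwa [← map_smul, Submodule.mkQ_apply, Submodule.Quotient.mk_eq_zero] at this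
  -- The map back is `f⁻¹ ∘ c`, so that composing it with `f` gives multiplication by `c`.
  refine ⟨_, f, (LinearEquiv.ofInjective f hf).symm.toLinearMap ∘ₗ
    (c • LinearMap.id : M →ₗ[R] M).codRestrict (LinearMap.range f) hcf, c,
    nonZeroDivisors.ne_zero hc0, hcf, fun v => ⟨f v, ?_⟩⟩
  rw [LinearMap.comp_apply, LinearEquiv.coe_coe, LinearEquiv.symm_apply_eq]
  ext
  simp

end Comparison

/-! ### The Frobenius pushforward of `R`. -/

/-- The ring `R`, regarded as an `R`-algebra through the Frobenius endomorphism. -/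
def FrobeniusAlgebra (_p : ℕ) (R : Type*) : Type _ := R

namespace FrobeniusAlgebra

variable (p : ℕ) (R : Type*) [CommRing R]

instance : CommRing (FrobeniusAlgebra p R) := inferInstanceAs (CommRing R)

instance [IsLocalRing R] : IsLocalRing (FrobeniusAlgebra p R) := inferInstanceAs (IsLocalRing R)

instance [ExpChar R p] : Algebra R (FrobeniusAlgebra p R) :=
  RingHom.toAlgebra (S := FrobeniusAlgebra p R) (frobenius R p)

instance [ExpChar R p] : IsLocalHom (algebraMap R (FrobeniusAlgebra p R)) :=
  ⟨fun a ha => (isUnit_pow_iff (expChar_pos R p).ne').1 (show IsUnit (M := R) (a ^ p) from ha)⟩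

end FrobeniusAlgebra

section Frobenius

variable {R : Type*} [CommRing R] [IsLocalRing R]

/-- Here `s` is the degree of the residue field over itself via Frobenius; restricting scalars
multiplies lengths by it. -/
lemma exists_length_quotient_smul_top_frobenius {p : ℕ} [ExpChar R p] (hF : IsFFinite R p) :
    ∃ s : ℕ, 0 < s ∧ ∀ I : Ideal R,
      length R (FrobeniusAlgebra p R ⧸ (I • ⊤ : Submodule R (FrobeniusAlgebra p R))) =
        s * length R (R ⧸ bracketPower I p) := by
  have : Module.Finite R (FrobeniusAlgebra p R) := hF
  let κ := IsLocalRing.ResidueField R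
  let κ' := IsLocalRing.ResidueField (FrobeniusAlgebra p R)
  have h1 : length κ κ' ≠ ⊤ := length_ne_top
  have h2 : 0 < length κ κ' := length_pos
  obtain ⟨s, hs⟩ := ENat.ne_top_iff_exists.1 h1
  refine ⟨s, ?_, fun I => ?_⟩
  · rw [← hs] at h2
    exact_mod_cast h2
  · have h3 : length (FrobeniusAlgebra p R)
        (FrobeniusAlgebra p R ⧸ I.map (algebraMap R (FrobeniusAlgebra p R))) =
        length R (R ⧸ bracketPower I p) := rfl
    rw [hs, mul_comm, ← h3, ← IsLocalRing.length_restrictScalars R, Ideal.smul_top_eq_map]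
    exact (Submodule.Quotient.restrictScalarsEquiv R _).length_eq

lemma exists_frobenius_comparison [IsDomain R] {p : ℕ} [ExpChar R p] (hF : IsFFinite R p) :
    ∃ (r s b : ℕ) (c : R), 0 < s ∧ c ≠ 0 ∧ ∀ I : Ideal R,
      s * length R (R ⧸ bracketPower I p) ≤
        r * length R (R ⧸ I) + b * length R (R ⧸ (I ⊔ Ideal.span {c})) ∧
      r * length R (R ⧸ I) ≤
        s * length R (R ⧸ bracketPower I p) + b * length R (R ⧸ (I ⊔ Ideal.span {c})) := by
  have : Module.Finite R (FrobeniusAlgebra p R) := hF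
  obtain ⟨s, hs0, hs⟩ := exists_length_quotient_smul_top_frobenius hF
  obtain ⟨r, f, g, c, hc, hf, hg⟩ := exists_maps_to_from_free (R := R) (FrobeniusAlgebra p R)
  obtain ⟨b, hb⟩ := exists_length_quotient_smul_top_le f hf
  obtain ⟨b', hb'⟩ := exists_length_quotient_smul_top_le g hg
  refine ⟨r, s, b + b', c, hs0, hc, fun I => ?_⟩
  have h1 := hb I
  have h2 := hb' I
  rw [hs, length_pi_quotient_smul_top] at h1 h2
  rw [Nat.cast_add, add_mul]
  exact ⟨h1.trans (add_le_add le_rfl le_self_add), h2.trans (add_le_add le_rfl le_add_self)⟩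

end Frobenius

open Filter

/-! ### Almost monotone and almost geometric real sequences. -/

section RealSequences

/-- The correction `2C/q^e` dominates the geometric tail of the errors because `q ≥ 2`. -/
lemma monotone_sub_of_le_succ_add {u : ℕ → ℝ} {q C : ℝ} (hq : 2 ≤ q) (hC : 0 ≤ C)
    (h : ∀ e, u e ≤ u (e + 1) + C / q ^ e) : Monotone fun e => u e - 2 * C / q ^ e := by
  refine monotone_nat_of_le_succ fun e => ?_
  have hq0 : 0 < q ^ e := by positivity
  have h1 : 2 * C / q ^ (e + 1) ≤ C / q ^ e := by
    rw [pow_succ, div_le_div_iff₀ (by positivity) hq0]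
    have := mul_le_mul_of_nonneg_left hq (mul_nonneg hC hq0.le)
    linarith
  have h2 : 2 * C / q ^ e = C / q ^ e + C / q ^ e := by ring
  have := h e
  linarith

lemma tendsto_const_div_pow_zero {q : ℝ} (hq : 2 ≤ q) (C : ℝ) :
    Tendsto (fun e : ℕ => C / q ^ e) atTop (nhds 0) :=
  tendsto_const_nhds.div_atTop (tendsto_pow_atTop_atTop_of_one_lt (by linarith))

lemma sub_le_of_le_succ_add {u : ℕ → ℝ} {q C η : ℝ} (hq : 2 ≤ q) (hC : 0 ≤ C)
    (h : ∀ e, u e ≤ u (e + 1) + C / q ^ e) (hη : Tendsto u atTop (nhds η)) (e : ℕ) :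
    u e - η ≤ 2 * C / q ^ e := by
  have h1 : Tendsto (fun e => u e - 2 * C / q ^ e) atTop (nhds (η - 0)) :=
    hη.sub (tendsto_const_div_pow_zero hq _)
  have h2 := (monotone_sub_of_le_succ_add hq hC h).ge_of_tendsto h1 e
  simp only [sub_zero] at h2
  linarith

lemma exists_tendsto_of_le_succ_add {u : ℕ → ℝ} {q C M : ℝ} (hq : 2 ≤ q) (hC : 0 ≤ C)
    (h : ∀ e, u e ≤ u (e + 1) + C / q ^ e) (hM : ∀ e, u e ≤ M) :
    ∃ η, Tendsto u atTop (nhds η) := by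
  have hb : BddAbove (Set.range fun e => u e - 2 * C / q ^ e) := by
    refine ⟨M, ?_⟩
    rintro _ ⟨e, rfl⟩
    have : 0 ≤ 2 * C / q ^ e := by positivity
    have := hM e
    simp only
    linarith
  have h1 := tendsto_atTop_ciSup (monotone_sub_of_le_succ_add hq hC h) hb
  have h2 := h1.add (tendsto_const_div_pow_zero hq (2 * C))
  simp only [sub_add_cancel] at h2
  exact ⟨_, h2⟩

/-- Telescoping bounds `(μ - 1) ∑ b e` uniformly, while the sum is at least `N δ`. -/
lemma eq_one_of_abs_succ_sub_mul_le {b : ℕ → ℝ} {q C M δ μ : ℝ} (hq : 2 ≤ q) (hC : 0 ≤ C)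
    (hδ : 0 < δ) (hb : ∀ e, δ ≤ b e) (hM : ∀ e, b e ≤ M)
    (h : ∀ e, |b (e + 1) - μ * b e| ≤ C / q ^ e) : μ = 1 := by
  by_contra hμ
  have hμ' : 0 < |μ - 1| := abs_pos.2 (sub_ne_zero.2 hμ)
  have hmono := monotone_sub_of_le_succ_add (u := fun N => ∑ e ∈ Finset.range N, -(C / q ^ e))
    hq hC (fun e => by rw [Finset.sum_range_succ]; linarith)
  have hgeom (N : ℕ) : ∑ e ∈ Finset.range N, C / q ^ e ≤ 2 * C := by
    have h1 := hmono (Nat.zero_le N)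
    have h2 : 0 ≤ 2 * C / q ^ N := by positivity
    simp only [Finset.range_zero, Finset.sum_empty, pow_zero, div_one,
      Finset.sum_neg_distrib] at h1
    linarith
  have hsum (N : ℕ) : |b N - b 0 - (μ - 1) * ∑ e ∈ Finset.range N, b e| ≤ 2 * C := by
    have : b N - b 0 - (μ - 1) * ∑ e ∈ Finset.range N, b e =
        ∑ e ∈ Finset.range N, (b (e + 1) - μ * b e) := by
      rw [← Finset.sum_range_sub, Finset.mul_sum, ← Finset.sum_sub_distrib]
      exact Finset.sum_congr rfl fun e _ => by ring
    rw [this]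
    exact (Finset.abs_sum_le_sum_abs _ _).trans
      ((Finset.sum_le_sum fun e _ => h e).trans (hgeom N))
  obtain ⟨N, hN⟩ := exists_nat_gt ((2 * C + M) / (|μ - 1| * δ))
  rw [div_lt_iff₀ (by positivity)] at hN
  have h1 : N * δ ≤ ∑ e ∈ Finset.range N, b e := by
    have := Finset.card_nsmul_le_sum (Finset.range N) b δ fun e _ => hb e
    simpa using this
  have h2 : |μ - 1| * (N * δ) ≤ |(μ - 1) * ∑ e ∈ Finset.range N, b e| := by
    rw [abs_mul]
    exact mul_le_mul_of_nonneg_left (h1.trans (le_abs_self _)) hμ'.le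
  have h3 : |b N - b 0| ≤ M := by
    have := hb 0; have := hb N; have := hM 0; have := hM N
    rw [abs_le]; constructor <;> linarith
  have h4 := abs_sub_abs_le_abs_sub ((μ - 1) * ∑ e ∈ Finset.range N, b e) (b N - b 0)
  rw [abs_sub_comm ((μ - 1) * ∑ e ∈ Finset.range N, b e) (b N - b 0)] at h4
  have := hsum N
  linarith [(by ring : |μ - 1| * (N * δ) = N * (|μ - 1| * δ))]

end RealSequences

/-! ### Elementary facts on Frobenius powers and `circ`. -/

section BracketPower

variable {R : Type*} [CommRing R]

lemma pow_mem_bracketPower {I : Ideal R} {y : R} {n : ℕ} (h : y ^ n ∈ I) (p : ℕ) :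
    y ^ (n * p) ∈ bracketPower I p :=
  Ideal.subset_span ⟨y ^ n, h, (pow_mul y n p).symm⟩

lemma bracketPower_le_pow {m I : Ideal R} {n : ℕ} (h : I ≤ m ^ n) (p : ℕ) :
    bracketPower I p ≤ m ^ (n * p) := by
  refine Ideal.span_le.2 ?_
  rintro _ ⟨x, hx, rfl⟩
  simp only [SetLike.mem_coe, pow_mul]
  exact Ideal.pow_mem_pow (h hx) p

lemma ne_zero_of_mem_circ [IsDomain R] {c : R} (hc : c ∈ circ R) : c ≠ 0 := by
  have h := hc ⊥ Ideal.isPrime_bot (ringKrullDim_eq_of_ringEquiv (RingEquiv.quotientBot R))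
  simpa using h

lemma natCast_mul_colength_le {I : Ideal R} {n C : ℕ} (hI : length R (R ⧸ I) ≠ ⊤)
    (h : length R (R ⧸ I) * n ≤ (C : ℕ)) : colength I * n ≤ C := by
  rw [← ENat.natCast_toNat hI] at h
  rw [colength]
  exact_mod_cast h

end BracketPower

/-! ### Real-valued colength estimates and the Frobenius scaling factor. -/

section Colength

variable {R : Type*} [CommRing R] [IsLocalRing R] [IsNoetherianRing R]

lemma exists_colength_le {d : ℕ} (hd : ringKrullDim R = d) :
    ∃ C : ℝ, 0 ≤ C ∧ ∀ (n : ℕ) (I : Ideal R), (∀ y ∈ IsLocalRing.maximalIdeal R, y ^ n ∈ I) →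
      length R (R ⧸ I) ≠ ⊤ ∧ colength I ≤ C * n ^ d := by
  obtain ⟨C, hC⟩ := exists_length_quotient_le hd
  refine ⟨C, Nat.cast_nonneg C, fun n I hI => ?_⟩
  have h := hC n I hI
  have h0 : length R (R ⧸ I) ≠ ⊤ := ne_top_of_le_ne_top (ENat.natCast_ne_top _) h
  refine ⟨h0, ?_⟩
  have := natCast_mul_colength_le (n := 1) (C := C * n ^ d) h0 (by rwa [Nat.cast_one, mul_one])
  simpa using this

lemma exists_colength_sup_span_le [IsDomain R] {d : ℕ} (hd : ringKrullDim R = d) {c : R}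
    (hc : c ≠ 0) :
    ∃ C : ℝ, 0 ≤ C ∧ ∀ (n : ℕ) (I : Ideal R), 0 < n →
      (∀ y ∈ IsLocalRing.maximalIdeal R, y ^ n ∈ I) →
      colength (I ⊔ Ideal.span {c}) ≤ C * (n ^ d / n) := by
  obtain ⟨C, hC⟩ := exists_length_quotient_sup_span_mul_le hd hc
  obtain ⟨_, _, hfin⟩ := exists_colength_le hd
  refine ⟨C, Nat.cast_nonneg C, fun n I hn hI => ?_⟩
  have h0 := (hfin n (I ⊔ Ideal.span {c}) fun y hy => (le_sup_left : I ≤ _) (hI y hy)).1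
  have h := natCast_mul_colength_le h0 (hC n I hI)
  rw [← mul_div_assoc, le_div_iff₀ (by exact_mod_cast hn)]
  exact_mod_cast h

lemma exists_colength_le_add [IsDomain R] {d : ℕ} (hd : ringKrullDim R = d) {c : R}
    (hc : c ≠ 0) :
    ∃ C : ℝ, 0 ≤ C ∧ ∀ (n : ℕ) (I K : Ideal R), 0 < n →
      (∀ y ∈ IsLocalRing.maximalIdeal R, y ^ n ∈ I) →
      (∀ y ∈ IsLocalRing.maximalIdeal R, y ^ n ∈ K) → Ideal.span {c} * K ≤ I →
      colength I ≤ colength K + C * (n ^ d / n) := by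
  obtain ⟨C, hC0, hC⟩ := exists_colength_sup_span_le hd hc
  obtain ⟨_, _, hfin⟩ := exists_colength_le hd
  refine ⟨C, hC0, fun n I K hn hI hK hcK => ?_⟩
  have h1 := length_quotient_le_add_of_mul_mem (I := I) (K := K) (c := c) fun x hx =>
    hcK (Ideal.mul_mem_mul (Ideal.mem_span_singleton_self c) hx)
  have hI' : ∀ y ∈ IsLocalRing.maximalIdeal R, y ^ n ∈ I ⊔ Ideal.span {c} :=
    fun y hy => (le_sup_left : I ≤ _) (hI y hy)
  rw [← ENat.natCast_toNat (hfin n I hI).1, ← ENat.natCast_toNat (hfin n K hK).1,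
    ← ENat.natCast_toNat (hfin n _ hI').1] at h1
  have h2 : colength I ≤ colength K + colength (I ⊔ Ideal.span {c}) := by
    simp only [colength]
    exact_mod_cast h1
  have := hC n I hn hI
  linarith

lemma exists_abs_colength_bracketPower_sub_mul_le [IsDomain R] {p : ℕ} [ExpChar R p]
    (hF : IsFFinite R p) {d : ℕ} (hd : ringKrullDim R = d) :
    ∃ lam C : ℝ, 0 ≤ C ∧ ∀ (n : ℕ) (I : Ideal R), 0 < n →
      (∀ y ∈ IsLocalRing.maximalIdeal R, y ^ n ∈ I) →
      |colength (bracketPower I p) - lam * colength I| ≤ C * (n ^ d / n) := by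
  obtain ⟨r, s, b, c, hs, hc, h⟩ := exists_frobenius_comparison hF
  obtain ⟨C, hC0, hC⟩ := exists_colength_sup_span_le hd hc
  obtain ⟨_, _, hfin⟩ := exists_colength_le hd
  have hs' : (0 : ℝ) < s := by exact_mod_cast hs
  refine ⟨r / s, b * C / s, by positivity, fun n I hn hI => ?_⟩
  have hI' : ∀ y ∈ IsLocalRing.maximalIdeal R, y ^ n ∈ I ⊔ Ideal.span {c} :=
    fun y hy => (le_sup_left : I ≤ _) (hI y hy)
  have h1 := h I
  rw [← ENat.natCast_toNat (hfin n I hI).1,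
    ← ENat.natCast_toNat (hfin _ _ fun y hy => pow_mem_bracketPower (hI y hy) p).1,
    ← ENat.natCast_toNat (hfin n _ hI').1] at h1
  have h2 : s * colength (bracketPower I p) ≤
      r * colength I + b * colength (I ⊔ Ideal.span {c}) := by
    simp only [colength]
    exact_mod_cast h1.1
  have h3 : r * colength I ≤
      s * colength (bracketPower I p) + b * colength (I ⊔ Ideal.span {c}) := by
    simp only [colength]
    exact_mod_cast h1.2
  have h4 := mul_le_mul_of_nonneg_left (hC n I hn hI) (Nat.cast_nonneg (α := ℝ) b)
  have h5 : |s * colength (bracketPower I p) - r * colength I| ≤ b * (C * (n ^ d / n)) := by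
    rw [abs_le]
    constructor <;> linarith
  have h6 : colength (bracketPower I p) - r / s * colength I =
      (s * colength (bracketPower I p) - r * colength I) / s := by
    field_simp
  rw [h6, abs_div, abs_of_pos hs', div_le_iff₀ hs']
  refine h5.trans (le_of_eq ?_)
  field_simp

/-- The Frobenius multiplies colengths by `p ^ d`, up to an error of order `n ^ (d - 1)`. -/
lemma exists_abs_colength_bracketPower_sub_le [IsDomain R] {p : ℕ} [Fact p.Prime] [CharP R p]
    (hF : IsFFinite R p) {d : ℕ} (hd : ringKrullDim R = d) :
    ∃ C : ℝ, 0 ≤ C ∧ ∀ (n : ℕ) (I : Ideal R), 0 < n →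
      (∀ y ∈ IsLocalRing.maximalIdeal R, y ^ n ∈ I) →
      |colength (bracketPower I p) - p ^ d * colength I| ≤ C * (n ^ d / n) := by
  obtain ⟨lam, C, hC0, hC⟩ := exists_abs_colength_bracketPower_sub_mul_le hF hd
  refine ⟨C, hC0, ?_⟩
  suffices hlam : lam / p ^ d = 1 by
    have hp : (p : ℝ) ^ d ≠ 0 := by
      have := (Fact.out : p.Prime).pos
      positivity
    rwa [← (div_eq_one_iff_eq hp).1 hlam]
  have hp2 : (2 : ℝ) ≤ p := by exact_mod_cast (Fact.out : p.Prime).two_le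
  have hp0 : 0 < p := (Fact.out : p.Prime).pos
  obtain ⟨D, hD⟩ := exists_pow_le_length_quotient_pow hd
  obtain ⟨M, hM0, hM⟩ := exists_colength_le hd
  -- The iterated Frobenius powers of `𝔪` serve as test family: their colengths divided by `q^d` lie
  -- between `1/D` and `M`, which forces `lam = p^d`.
  let J : ℕ → Ideal R := fun e =>
    Nat.rec (IsLocalRing.maximalIdeal R) (fun _ K => bracketPower K p) e
  have hJs (e : ℕ) : J (e + 1) = bracketPower (J e) p := rfl
  have hJ1 (e : ℕ) : ∀ y ∈ IsLocalRing.maximalIdeal R, y ^ p ^ e ∈ J e := by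
    induction e with
    | zero => simp [J]
    | succ e ih =>
      intro y hy
      rw [hJs, pow_succ]
      exact pow_mem_bracketPower (ih y hy) p
  have hJ2 (e : ℕ) : J e ≤ IsLocalRing.maximalIdeal R ^ p ^ e := by
    induction e with
    | zero => simp [J]
    | succ e ih =>
      rw [hJs, pow_succ]
      exact bracketPower_le_pow ih p
  have hlow (e : ℕ) : ((p : ℝ) ^ e) ^ d ≤ D * colength (J e) := by
    have h1 := (hD (p ^ e) (by positivity)).trans
      (mul_le_mul_right (length_quotient_anti (hJ2 e)) _)
    rw [← ENat.natCast_toNat (hM _ _ (hJ1 e)).1] at h1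
    rw [colength]
    exact_mod_cast h1
  have hDpos : (0 : ℝ) < D := by
    refine lt_of_le_of_ne (Nat.cast_nonneg D) fun h0 => ?_
    have := hlow 0
    rw [← h0] at this
    norm_num at this
  refine eq_one_of_abs_succ_sub_mul_le (b := fun e => colength (J e) / ((p : ℝ) ^ e) ^ d)
    (C := C / p ^ d) (M := M) (δ := 1 / D) hp2 (by positivity) (by positivity)
    (fun e => ?_) (fun e => ?_) fun e => ?_
  · rw [div_le_div_iff₀ hDpos (by positivity), one_mul, mul_comm]
    exact hlow e
  · rw [div_le_iff₀ (by positivity)]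
    have := (hM _ _ (hJ1 e)).2
    exact_mod_cast this
  · have h1 := hC (p ^ e) (J e) (by positivity) (hJ1 e)
    rw [← hJs] at h1
    have h2 : colength (J (e + 1)) / ((p : ℝ) ^ (e + 1)) ^ d -
        lam / p ^ d * (colength (J e) / ((p : ℝ) ^ e) ^ d) =
        (colength (J (e + 1)) - lam * colength (J e)) / (p ^ d * (p ^ e) ^ d) := by
      rw [pow_succ, mul_pow]
      field_simp
    rw [h2, abs_div, abs_of_pos (by positivity : (0 : ℝ) < p ^ d * (p ^ e) ^ d),
      div_le_iff₀ (by positivity)]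
    refine h1.trans (le_of_eq ?_)
    push_cast
    field_simp

end Colength

end AsymptoticColength

/-! ### The main theorem. -/

theorem mainTheorem6 (p : ℕ) [Fact p.Prime] {R : Type*} [CommRing R] [IsDomain R]
    [IsLocalRing R] [IsNoetherianRing R] [CharP R p]
    (hF : AsymptoticColength.IsFFinite R p)
    (d : ℕ) (hd : ringKrullDim R = d)
    (I : ℕ → Ideal R)
    (hBBL : AsymptoticColength.IsBBL p I)
    (hinv : AsymptoticColength.IsWeaklyInversePFamily p I) :
    (∀ e : ℕ, Module.length R (R ⧸ I e) ≠ ⊤) ∧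
    ∃ η : ℝ,
      Filter.Tendsto (fun e : ℕ => AsymptoticColength.colength (I e) / ((p : ℝ) ^ e) ^ d)
        Filter.atTop (nhds η) ∧
      (∃ C : ℝ, 0 < C ∧ ∀ e : ℕ,
        AsymptoticColength.colength (I e) / ((p : ℝ) ^ e) ^ d - η ≤ C / (p : ℝ) ^ e) ∧
      (AsymptoticColength.IsWeaklyPFamily p I →
        ∃ C : ℝ, 0 < C ∧ ∀ e : ℕ,
          |AsymptoticColength.colength (I e) / ((p : ℝ) ^ e) ^ d - η| ≤ C / (p : ℝ) ^ e) := by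
  open AsymptoticColength in
  have hp2 : (2 : ℝ) ≤ p := by exact_mod_cast (Fact.out : p.Prime).two_le
  have hp0 : 0 < p := (Fact.out : p.Prime).pos
  obtain ⟨M, hM0, hM⟩ := exists_colength_le hd
  obtain ⟨B, hB0, hB⟩ := exists_abs_colength_bracketPower_sub_le hF hd
  obtain ⟨a, ha0, ha⟩ : ∃ a : ℕ, 0 < a ∧ ∀ (e : ℕ), ∀ y ∈ IsLocalRing.maximalIdeal R,
      y ^ (a * p ^ e) ∈ I e := by
    obtain ⟨a, ha⟩ := hBBL
    -- The shift makes the exponent positive, as the error terms `n^d / n` require.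
    refine ⟨a + 1, a.succ_pos, fun e y hy => ha e ?_⟩
    exact Ideal.pow_le_pow_right (Nat.mul_le_mul_right _ a.le_succ) (Ideal.pow_mem_pow hy _)
  have hab (e : ℕ) : ∀ y ∈ IsLocalRing.maximalIdeal R,
      y ^ (a * p ^ (e + 1)) ∈ bracketPower (I e) p := fun y hy => by
    rw [pow_succ, ← mul_assoc]
    exact pow_mem_bracketPower (ha e y hy) p
  have hpos (e : ℕ) : 0 < a * p ^ e := by positivity
  have herr (e : ℕ) : ((a * p ^ e : ℕ) : ℝ) ^ d / (a * p ^ e : ℕ) =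
      ((p : ℝ) ^ e) ^ d * ((a ^ d / a) / p ^ e) := by
    push_cast
    rw [mul_pow]
    field_simp
  have hsucc (x : ℝ) (e : ℕ) : x / ((p : ℝ) ^ (e + 1)) ^ d = x / p ^ d / (p ^ e) ^ d := by
    rw [pow_succ, mul_pow]
    field_simp
  set u : ℕ → ℝ := fun e => colength (I e) / ((p : ℝ) ^ e) ^ d with hu
  have hbr (e : ℕ) : |colength (bracketPower (I e) p) / ((p : ℝ) ^ (e + 1)) ^ d - u e| ≤
      B * (a ^ d / a) / p ^ d / p ^ e := by
    have h1 := hB _ _ (hpos e) (ha e)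
    rw [herr] at h1
    have h2 : colength (bracketPower (I e) p) / ((p : ℝ) ^ (e + 1)) ^ d - u e =
        (colength (bracketPower (I e) p) - p ^ d * colength (I e)) / (p ^ d * (p ^ e) ^ d) := by
      rw [hsucc]
      simp only [hu]
      field_simp
    rw [h2, abs_div, abs_of_pos (by positivity : (0 : ℝ) < p ^ d * (p ^ e) ^ d),
      div_le_iff₀ (by positivity)]
    refine h1.trans (le_of_eq ?_)
    field_simp
  have hstep {c : R} (hc : c ∈ circ R) : ∃ C : ℝ, 0 ≤ C ∧ ∀ (e : ℕ) (K L : Ideal R),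
      (∀ y ∈ IsLocalRing.maximalIdeal R, y ^ (a * p ^ (e + 1)) ∈ K) →
      (∀ y ∈ IsLocalRing.maximalIdeal R, y ^ (a * p ^ (e + 1)) ∈ L) →
      Ideal.span {c} * L ≤ K → colength K / ((p : ℝ) ^ (e + 1)) ^ d ≤
        colength L / ((p : ℝ) ^ (e + 1)) ^ d + C / p ^ e := by
    obtain ⟨A, hA0, hA⟩ := exists_colength_le_add hd (ne_zero_of_mem_circ hc)
    refine ⟨A * (a ^ d / a) / p, by positivity, fun e K L hK hL hKL => ?_⟩
    have h1 := hA _ K L (hpos (e + 1)) hK hL hKL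
    rw [herr] at h1
    rw [div_le_iff₀ (by positivity), add_mul, div_mul_cancel₀ _ (by positivity)]
    refine h1.trans (le_of_eq ?_)
    rw [pow_succ]
    field_simp
  obtain ⟨c, hc, hcI⟩ := hinv
  obtain ⟨A, hA0, hA⟩ := hstep hc
  have hup (e : ℕ) : u e ≤ u (e + 1) + (A + B * (a ^ d / a) / p ^ d) / p ^ e := by
    have h1 := hA e _ _ (hab e) (ha (e + 1)) (hcI e)
    have h2 := (abs_le.1 (hbr e)).1
    rw [add_div]
    simp only [hu] at h2 ⊢
    linarith
  have hE0 : 0 ≤ A + B * (a ^ d / a) / p ^ d := by positivity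
  have hbd (e : ℕ) : u e ≤ M * a ^ d := by
    rw [hu, div_le_iff₀ (by positivity), mul_assoc, ← mul_pow]
    have := (hM _ _ (ha e)).2
    exact_mod_cast this
  obtain ⟨η, hη⟩ := exists_tendsto_of_le_succ_add hp2 hE0 hup hbd
  have hle := sub_le_of_le_succ_add hp2 hE0 hup hη
  refine ⟨fun e => (hM _ _ (ha e)).1, η, hη,
    ⟨2 * (A + B * (a ^ d / a) / p ^ d) + 1, by positivity, fun e => (hle e).trans ?_⟩, ?_⟩
  · gcongr
    linarith
  · rintro ⟨c', hc', hcI'⟩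
    obtain ⟨A', hA0', hA'⟩ := hstep hc'
    -- The reverse inclusion makes `-u` almost nondecreasing too, which bounds `η - u e`.
    have hdown (e : ℕ) : -u e ≤ -u (e + 1) + (A' + B * (a ^ d / a) / p ^ d) / p ^ e := by
      have h1 := hA' e _ _ (ha (e + 1)) (hab e) (hcI' e)
      have h2 := (abs_le.1 (hbr e)).2
      rw [add_div]
      simp only [hu] at h2 ⊢
      linarith
    have hle' := sub_le_of_le_succ_add (u := fun e => -u e) hp2 (by positivity) hdown hη.neg
    refine ⟨2 * (A + B * (a ^ d / a) / p ^ d) + 2 * (A' + B * (a ^ d / a) / p ^ d) + 1,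
      by positivity, fun e => abs_le.2 ⟨?_, (hle e).trans ?_⟩⟩
    · have h1 := hle' e
      have h2 : 2 * (A' + B * (a ^ d / a) / p ^ d) / (p : ℝ) ^ e ≤
          (2 * (A + B * (a ^ d / a) / p ^ d) + 2 * (A' + B * (a ^ d / a) / p ^ d) + 1) /
            (p : ℝ) ^ e := by
        gcongr
        linarith
      simp only [hu] at h1 ⊢
      linarith
    · gcongr
      have : 0 ≤ A' + B * (a ^ d / a) / p ^ d := by positivity
      linarith
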